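/- For each $n\ge 1$ let $X=X_n$ be a fixed real $n\times p$ design matrix with $p=p_n$, let $\beta=\beta_n\in\mathbb R^{p}$, let $S_0=\{j:\beta_j\neq 0\}$ be the true model, and let $y=X\beta+\varepsilon$ where $\varepsilon_1,\dots,\varepsilon_n$ are i.i.d. $N(0,\sigma^2)$ with a fixed $\sigma>0$. Assume that $|S_0|$ stays bounded as $n\to\infty$. For $S\subseteq\{1,\dots,p\}$ let $X_S$ be the matrix of the columns of $X$ with index in $S$, let $P_S$ be the orthogonal projection onto the column space of $X_S$ (so $P_S=X_S(X_S^TX_S)^{-1}X_S^T$ when $X_S^TX_S$ is invertible), and put $$\mu=X\beta,\qquad \delta(S)=\|\mu-P_S\mu\|^2,\qquad \mathrm{RSS}_S=\|y-P_Sy\|^2,$$ $$\mathrm{MDL}(S)=\frac n2\log\frac{\mathrm{RSS}_S}{n}+\frac{|S|}{2}\log n+|S|\log p .$$ Suppose that for some fixed $k>1$ the true model is asymptotically identifiable, that is, $$\lim_{n\to\infty}\ \min\Big\{\frac{\delta(S)}{\log n}\;:\; S_0\not\subseteq S,\ |S|\le k|S_0|\Big\}=\infty ,$$ and that $p=O(n^{\gamma})$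 for some fixed $\gamma$. Then $$P\Big(\min_{S\neq S_0,\ |S|\le k|S_0|}\mathrm{MDL}(S)>\mathrm{MDL}(S_0)\Big)\to 1\qquad (n\to\infty),$$ where a minimum over an empty family of models is $+\infty$. -/

import Mathlib

open Filter Topology MeasureTheory ProbabilityTheory

noncomputable section

namespace LinModel

/-- The candidate design matrix `X_S`: the columns of `X` with index in `S`. -/
def subDesign {n p : ℕ} (X : Matrix (Fin n) (Fin p) ℝ) (S : Finset (Fin p)) :
    Matrix (Fin n) S ℝ :=
  X.submatrix id Subtype.val

/-- The column space of `X_S`, a subspace of Euclidean `ℝⁿ`. -/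
def colSpan {n p : ℕ} (X : Matrix (Fin n) (Fin p) ℝ) (S : Finset (Fin p)) :
    Submodule ℝ (EuclideanSpace ℝ (Fin n)) :=
  Submodule.span ℝ (Set.range fun j : S => WithLp.toLp 2 ((subDesign X S).col j))

/-- `P_S v`: the orthogonal projection of `v` onto the column space of `X_S`. It is the vector of
fitted values `X_S β̂_S`, and equals `X_S (X_Sᵀ X_S)⁻¹ X_Sᵀ v` when `X_Sᵀ X_S` is invertible
(see `fitted_eq_of_isUnit`). -/
def fitted {n p : ℕ} (X : Matrix (Fin n) (Fin p) ℝ) (S : Finset (Fin p))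
    (v : EuclideanSpace ℝ (Fin n)) : EuclideanSpace ℝ (Fin n) :=
  (colSpan X S).starProjection v

/-- The residual sum of squares of the candidate model `S` for the response `y`. -/
def rss {n p : ℕ} (X : Matrix (Fin n) (Fin p) ℝ) (y : EuclideanSpace ℝ (Fin n))
    (S : Finset (Fin p)) : ℝ :=
  ‖y - fitted X S y‖ ^ 2

/-- `MDL(S) = (n/2) log(RSS/n) + (|S|/2) log n + |S| log p`. -/
def mdl {n p : ℕ} (X : Matrix (Fin n) (Fin p) ℝ) (y : EuclideanSpace ℝ (Fin n))
    (S : Finset (Fin p)) : ℝ :=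
  (n : ℝ) / 2 * Real.log (rss X y S / n) + (S.card : ℝ) / 2 * Real.log n
    + (S.card : ℝ) * Real.log p

/-- The true model `S₀`: the set of indices of the nonzero regression coefficients. -/
def trueModel {p : ℕ} (β : Fin p → ℝ) : Finset (Fin p) :=
  Finset.univ.filter fun j => β j ≠ 0

/-- The mean response `μ = X β`. -/
def meanResponse {n p : ℕ} (X : Matrix (Fin n) (Fin p) ℝ) (β : Fin p → ℝ) :
    EuclideanSpace ℝ (Fin n) :=
  WithLp.toLp 2 (X.mulVec β)

/-- The response `y = X β + e`. -/
def response {n p : ℕ} (X : Matrix (Fin n) (Fin p) ℝ) (β : Fin p → ℝ) (e : Fin n → ℝ) :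
    EuclideanSpace ℝ (Fin n) :=
  WithLp.toLp 2 (X.mulVec β + e)

/-- `δ(S) = ‖μ - P_S μ‖²`. -/
def delta {n p : ℕ} (X : Matrix (Fin n) (Fin p) ℝ) (β : Fin p → ℝ) (S : Finset (Fin p)) : ℝ :=
  ‖meanResponse X β - fitted X S (meanResponse X β)‖ ^ 2

/-- Asymptotic identifiability with constant `k`: the minimum of `δ(S) / log n` over the models `S`
that do not contain `S₀` and satisfy `|S| ≤ k |S₀|` tends to infinity with `n`. -/
def AsympIdentifiable {p : ℕ → ℕ} (X : ∀ n, Matrix (Fin n) (Fin (p n)) ℝ)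
    (β : ∀ n, Fin (p n) → ℝ) (k : ℝ) : Prop :=
  ∀ C : ℝ, ∀ᶠ n : ℕ in atTop, ∀ S : Finset (Fin (p n)),
    ¬ trueModel (β n) ⊆ S → (S.card : ℝ) ≤ k * ((trueModel (β n)).card : ℝ) →
      C ≤ delta (X n) (β n) S / Real.log n

theorem mulVec_mem_colSpan {n p : ℕ} (X : Matrix (Fin n) (Fin p) ℝ) (S : Finset (Fin p))
    (b : S → ℝ) : WithLp.toLp 2 ((subDesign X S).mulVec b) ∈ colSpan X S := by
  have h : WithLp.toLp 2 ((subDesign X S).mulVec b)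
      = ∑ j, b j • (WithLp.toLp 2 ((subDesign X S).col j) : EuclideanSpace ℝ (Fin n)) := by
    ext i
    simp [Matrix.mulVec, dotProduct, mul_comm]
  rw [h]
  exact Submodule.sum_mem _ fun j _ => Submodule.smul_mem _ _ (Submodule.subset_span ⟨j, rfl⟩)

/-- `fitted` is the projection matrix `X_S (X_Sᵀ X_S)⁻¹ X_Sᵀ` whenever that matrix makes sense. -/
theorem fitted_eq_of_isUnit {n p : ℕ} (X : Matrix (Fin n) (Fin p) ℝ) (S : Finset (Fin p))
    (hS : IsUnit ((subDesign X S).transpose * subDesign X S).det)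
    (v : EuclideanSpace ℝ (Fin n)) :
    fitted X S v = WithLp.toLp 2
      ((subDesign X S * ((subDesign X S).transpose * subDesign X S)⁻¹
        * (subDesign X S).transpose).mulVec v.ofLp) := by
  set A := subDesign X S with hA
  refine Submodule.eq_starProjection_of_mem_orthogonal (K := colSpan X S) ?_ ?_
  · rw [Matrix.mul_assoc, ← Matrix.mulVec_mulVec]
    exact mulVec_mem_colSpan X S _
  · rw [colSpan, Submodule.mem_orthogonal]
    have key : A.transpose.mulVec
        (v.ofLp - (A * (A.transpose * A)⁻¹ * A.transpose).mulVec v.ofLp) = 0 := by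
      rw [Matrix.mulVec_sub, Matrix.mulVec_mulVec, ← Matrix.mul_assoc, ← Matrix.mul_assoc,
        Matrix.mul_nonsing_inv _ hS, Matrix.one_mul, sub_self]
    intro u hu
    induction hu using Submodule.span_induction with
    | mem x hx =>
      obtain ⟨j, rfl⟩ := hx
      have := congrFun key j
      simpa [PiLp.inner_apply, Matrix.mulVec, dotProduct, mul_comm] using this
    | zero => simp
    | add x y _ _ hx hy => rw [inner_add_left, hx, hy, add_zero]
    | smul a x _ hx => rw [inner_smul_left, hx, mul_zero]

/-- `rss` is the least-squares minimum of `‖y - X_S b‖²` over the coefficient vectors `b`. -/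
theorem rss_isLeast {n p : ℕ} (X : Matrix (Fin n) (Fin p) ℝ) (S : Finset (Fin p))
    (y : EuclideanSpace ℝ (Fin n)) :
    IsLeast (Set.range fun b : S → ℝ => ‖y - WithLp.toLp 2 ((subDesign X S).mulVec b)‖ ^ 2)
      (rss X y S) := by
  constructor
  · have h : fitted X S y ∈ colSpan X S := Submodule.starProjection_apply_mem _ _
    obtain ⟨b, hb⟩ := (Submodule.mem_span_range_iff_exists_fun ℝ).1 h
    refine ⟨b, ?_⟩
    have h2 : WithLp.toLp 2 ((subDesign X S).mulVec b) = fitted X S y := by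
      rw [← hb]
      ext i
      simp [Matrix.mulVec, dotProduct, mul_comm]
    simp only [h2, rss]
  · rintro _ ⟨b, rfl⟩
    have h : ‖y - fitted X S y‖ ≤ ‖y - WithLp.toLp 2 ((subDesign X S).mulVec b)‖ := by
      rw [fitted, Submodule.starProjection_minimal]
      exact ciInf_le ⟨0, by rintro _ ⟨x, rfl⟩; exact norm_nonneg _⟩
        (⟨_, mulVec_mem_colSpan X S b⟩ : colSpan X S)
    exact pow_le_pow_left₀ (norm_nonneg _) h 2

end LinModel

end

namespace LinModel

/-! Write `y = μ + σz` with `z` standard Gaussian. Outside a set of `z` of vanishing probability,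
three bounds hold and the rest is deterministic: `‖z‖²` is within `ηn` of `n`; `‖P_T z‖² ≤ |T| C log
n` for all `T`; adjoining any `T` to `S₀` captures at most `|T| (1 - 3η)(log n + 2 log p)` of
`‖z‖²`. The last two come from one union bound: Chernoff gives each `T` probability at most `a^|T|`,
with `a` a constant times `exp (-t u)` and `t < 1/2`, and the sum over nonempty `T` is `(1 + a)^p -
1`, which vanishes when `p a → 0`. For `t` near `1/2` and `u` near `log n + 2 log p`, `p a` is about
`n^(-1/2)`.

If `S` properly contains `S₀`, its gain in fit stays below the penalty `(log n + 2 log p) / 2` per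
extra variable (`mdl_lt_mdl_of_ssubset`). If `S` misses part of `S₀`, `δ(S)` exceeds any multiple of
`log n`, hence the noise terms, and the loss of fit outweighs the `O(log n)` penalty of `S₀`
(`mdl_lt_mdl_of_le_delta`). -/

/-! ### Chi-square tails and the union bound over models -/

theorem integrable_exp_mul_sq_gaussianReal {t : ℝ} (ht : t < 1 / 2) :
    Integrable (fun x : ℝ => Real.exp (t * x ^ 2)) (gaussianReal 0 1) := by
  rw [gaussianReal_of_var_ne_zero 0 one_ne_zero,
    integrable_withDensity_iff (measurable_gaussianPDF 0 1)
      (Filter.Eventually.of_forall fun _ => gaussianPDF_lt_top)]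
  have h := (integrable_exp_neg_mul_sq (b := 1 / 2 - t) (by linarith)).const_mul
    (Real.sqrt (2 * Real.pi))⁻¹
  refine h.congr (Filter.Eventually.of_forall fun x => ?_)
  simp only [toReal_gaussianPDF, gaussianPDFReal, NNReal.coe_one, mul_one, sub_zero]
  rw [mul_left_comm, ← Real.exp_add]
  congr 2
  ring

theorem norm_sq_sum_smul_orthonormalBasis {E : Type*} [NormedAddCommGroup E]
    [InnerProductSpace ℝ E] {ι : Type*} [Fintype ι] (b : OrthonormalBasis ι ℝ E)
    (x : ι → ℝ) : ‖∑ i, x i • b i‖ ^ 2 = ∑ i, x i ^ 2 := by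
  rw [← b.sum_sq_inner_right]
  refine Finset.sum_congr rfl fun i _ => ?_
  rw [b.orthonormal.inner_right_fintype]

section StdGaussian

variable {E : Type*} [NormedAddCommGroup E] [InnerProductSpace ℝ E] [FiniteDimensional ℝ E]
  [MeasurableSpace E] [BorelSpace E]

/-- For `t ∈ W` the projection drops out of `⟪P z, t⟫`, so the two characteristic functions agree.
-/
theorem stdGaussian_map_orthogonalProjectionOnto (W : Submodule ℝ E) :
    (stdGaussian E).map W.orthogonalProjectionOnto = stdGaussian W := by
  apply Measure.ext_of_charFun
  ext t
  rw [charFun_stdGaussian, charFun_apply, integral_map (by fun_prop) (by fun_prop)]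
  simp_rw [Submodule.inner_orthogonalProjectionOnto_eq_of_mem_right]
  have h := charFun_stdGaussian (t : E)
  rw [charFun_apply] at h
  rw [Submodule.coe_norm, ← h]

theorem integrable_exp_mul_norm_sq_stdGaussian {t : ℝ} (ht : t < 1 / 2) :
    Integrable (fun z : E => Real.exp (t * ‖z‖ ^ 2)) (stdGaussian E) := by
  rw [stdGaussian_eq_map_pi_orthonormalBasis (stdOrthonormalBasis ℝ E),
    integrable_map_measure (by fun_prop) (Measurable.aemeasurable (by fun_prop))]
  have h := Integrable.fintype_prod (ι := Fin (Module.finrank ℝ E))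
    (f := fun _ (x : ℝ) => Real.exp (t * x ^ 2)) (μ := fun _ => gaussianReal 0 1)
    (fun _ => integrable_exp_mul_sq_gaussianReal ht)
  refine h.congr (Filter.Eventually.of_forall fun x => ?_)
  simp only [Function.comp, norm_sq_sum_smul_orthonormalBasis, Finset.mul_sum, Real.exp_sum]

theorem mgf_norm_sq_stdGaussian (t : ℝ) :
    mgf (fun z : E => ‖z‖ ^ 2) (stdGaussian E) t
      = (∫ x, Real.exp (t * x ^ 2) ∂(gaussianReal 0 1)) ^ Module.finrank ℝ E := by
  rw [mgf, stdGaussian_eq_map_pi_orthonormalBasis (stdOrthonormalBasis ℝ E),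
    integral_map (Measurable.aemeasurable (by fun_prop)) (by fun_prop)]
  simp_rw [norm_sq_sum_smul_orthonormalBasis, Finset.mul_sum, Real.exp_sum]
  rw [integral_fintype_prod_eq_prod (fun _ (x : ℝ) => Real.exp (t * x ^ 2))]
  simp

/-- Chernoff bound for the squared norm of the projection of a standard Gaussian vector. -/
theorem stdGaussian_real_le_norm_sq_starProjection_le {t : ℝ} (ht0 : 0 ≤ t) (ht : t < 1 / 2)
    (W : Submodule ℝ E) (u : ℝ) :
    (stdGaussian E).real {z | u ≤ ‖W.starProjection z‖ ^ 2}
      ≤ Real.exp (-t * u)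
        * (∫ x, Real.exp (t * x ^ 2) ∂(gaussianReal 0 1)) ^ Module.finrank ℝ W := by
  have h := measure_ge_le_exp_mul_mgf (μ := stdGaussian W) (X := fun z : W => ‖z‖ ^ 2) u ht0
    (integrable_exp_mul_norm_sq_stdGaussian ht)
  rw [mgf_norm_sq_stdGaussian, ← stdGaussian_map_orthogonalProjectionOnto,
    map_measureReal_apply (by fun_prop)
      (measurableSet_le measurable_const (by fun_prop))] at h
  exact h

/-- Allows the exponent `finrank (W T)` in the Chernoff bound to be raised to `|T|`. -/
theorem one_le_integral_exp_mul_sq {t : ℝ} (ht0 : 0 ≤ t) (ht : t < 1 / 2) :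
    1 ≤ ∫ x, Real.exp (t * x ^ 2) ∂(gaussianReal 0 1) := by
  calc (1 : ℝ) = ∫ _, (1 : ℝ) ∂(gaussianReal 0 1) := by simp
    _ ≤ _ := integral_mono (integrable_const _) (integrable_exp_mul_sq_gaussianReal ht)
      fun x => Real.one_le_exp (by positivity)

/-- Union bound over all the nonempty subsets `T` of a set of `p` indices, for projections onto
subspaces of dimension at most `|T|`. -/
theorem stdGaussian_real_exists_lt_norm_sq_starProjection_le {t : ℝ} (ht0 : 0 ≤ t)
    (ht : t < 1 / 2) {p : ℕ} (W : Finset (Fin p) → Submodule ℝ E)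
    (hW : ∀ T, Module.finrank ℝ (W T) ≤ T.card) (u : ℝ) :
    (stdGaussian E).real {z | ∃ T, T.card * u < ‖(W T).starProjection z‖ ^ 2}
      ≤ Real.exp (p * ((∫ x, Real.exp (t * x ^ 2) ∂(gaussianReal 0 1)) * Real.exp (-t * u)))
        - 1 := by
  set c := ∫ x, Real.exp (t * x ^ 2) ∂(gaussianReal 0 1) with hc
  have hc1 : 1 ≤ c := one_le_integral_exp_mul_sq ht0 ht
  set a := c * Real.exp (-t * u)
  have ha : 0 ≤ a := by positivity
  have hsub : {z : E | ∃ T, T.card * u < ‖(W T).starProjection z‖ ^ 2}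
      ⊆ ⋃ T ∈ (Finset.univ : Finset (Finset (Fin p))).erase ∅,
        {z | T.card * u ≤ ‖(W T).starProjection z‖ ^ 2} := by
    rintro z ⟨T, hT⟩
    simp only [Set.mem_iUnion, Finset.mem_erase, Finset.mem_univ, and_true]
    refine ⟨T, ?_, hT.le⟩
    -- The empty set drops out because its subspace is zero and the inequality is strict.
    rintro rfl
    have h0 : W ∅ = ⊥ := Submodule.finrank_eq_zero.1 (by simpa using hW ∅)
    simp [h0] at hT
  have hT : ∀ T : Finset (Fin p),
      (stdGaussian E).real {z | T.card * u ≤ ‖(W T).starProjection z‖ ^ 2} ≤ a ^ T.card := by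
    intro T
    refine (stdGaussian_real_le_norm_sq_starProjection_le ht0 ht (W T) _).trans ?_
    rw [mul_pow, ← Real.exp_nat_mul, mul_comm (c ^ _),
      show (T.card : ℝ) * (-t * u) = -t * (T.card * u) by ring]
    gcongr
    exact hW T
  calc _ ≤ _ := measureReal_mono hsub (measure_ne_top _ _)
    _ ≤ ∑ T ∈ (Finset.univ : Finset (Finset (Fin p))).erase ∅,
        (stdGaussian E).real {z | T.card * u ≤ ‖(W T).starProjection z‖ ^ 2} :=
      measureReal_biUnion_finset_le _ _
    _ ≤ ∑ T ∈ (Finset.univ : Finset (Finset (Fin p))).erase ∅, a ^ T.card :=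
      Finset.sum_le_sum fun T _ => hT T
    _ = (a + 1) ^ p - 1 := by
      have h := Fintype.sum_pow_mul_eq_add_pow (Fin p) a 1
      simp only [one_pow, mul_one, Fintype.card_fin] at h
      rw [← h, ← Finset.add_sum_erase _ _ (Finset.mem_univ (∅ : Finset (Fin p)))]
      simp
    _ ≤ Real.exp (p * a) - 1 := by
      rw [Real.exp_nat_mul]
      gcongr
      exact Real.add_one_le_exp a

end StdGaussian

/-! ### Concentration of the squared norm -/

theorem memLp_sq_gaussianReal : MemLp (fun x : ℝ => x ^ 2) 2 (gaussianReal 0 1) := by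
  have h := (memLp_id_gaussianReal' (μ := 0) (v := 1) 4 (by simp)).norm_rpow_div 2
  refine (memLp_congr_norm (by simp; fun_prop) (by fun_prop) ?_).1 (h.mono_exponent ?_)
  · refine Filter.Eventually.of_forall fun x => ?_
    simp
  · rw [ENNReal.le_div_iff_mul_le (by simp) (by simp)]
    norm_num

theorem integral_sq_gaussianReal : ∫ x, x ^ 2 ∂(gaussianReal 0 1) = 1 := by
  have h := variance_fun_id_gaussianReal (μ := 0) (v := 1)
  rw [variance_of_integral_eq_zero (by fun_prop) (by simp)] at h
  simpa using h

/-- The squared norm of a standard Gaussian vector of `ℝⁿ` concentrates around `n`. -/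
theorem tendsto_stdGaussian_real_le_abs_norm_sq_sub {η : ℝ} (hη : 0 < η) :
    Tendsto (fun n : ℕ => (stdGaussian (EuclideanSpace ℝ (Fin n))).real
      {z | η * n ≤ |‖z‖ ^ 2 - n|}) atTop (𝓝 0) := by
  set v := Var[fun x : ℝ => x ^ 2; gaussianReal 0 1]
  have hb : ∀ᶠ n : ℕ in atTop, (stdGaussian (EuclideanSpace ℝ (Fin n))).real
      {z | η * n ≤ |‖z‖ ^ 2 - n|} ≤ v / η ^ 2 / n := by
    filter_upwards [eventually_gt_atTop 0] with n hn
    have hn' : (0 : ℝ) < n := by exact_mod_cast hn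
    rw [← map_pi_eq_stdGaussian, map_measureReal_apply (by fun_prop)
      (measurableSet_le measurable_const (by fun_prop))]
    have hL : ∀ i : Fin n, MemLp (fun x : Fin n → ℝ => x i ^ 2) 2
        (Measure.pi fun _ : Fin n => gaussianReal 0 1) := fun i =>
      memLp_sq_gaussianReal.comp_measurePreserving (measurePreserving_eval _ i)
    have hS : MemLp (∑ i : Fin n, fun x : Fin n → ℝ => x i ^ 2) 2
        (Measure.pi fun _ : Fin n => gaussianReal 0 1) := memLp_finsetSum' _ fun i _ => hL i
    -- Chebyshev: the coordinates are independent, so the variance is `n v`.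
    have hch := meas_ge_le_variance_div_sq hS (c := η * n) (by positivity)
    rw [variance_sum_pi (X := fun _ (x : ℝ) => x ^ 2) (fun _ => memLp_sq_gaussianReal)] at hch
    have hE : ∫ x, (∑ i : Fin n, fun x : Fin n → ℝ => x i ^ 2) x
        ∂(Measure.pi fun _ : Fin n => gaussianReal 0 1) = n := by
      simp only [Finset.sum_apply]
      rw [integral_finsetSum _ fun i _ => (hL i).integrable (by norm_num)]
      have : ∀ i : Fin n, ∫ x : Fin n → ℝ, x i ^ 2
          ∂(Measure.pi fun _ : Fin n => gaussianReal 0 1) = 1 := fun i => by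
        have h := integral_map (μ := Measure.pi fun _ : Fin n => gaussianReal 0 1)
          (φ := Function.eval i) (f := fun x : ℝ => x ^ 2)
          (measurable_pi_apply i).aemeasurable (by fun_prop)
        rw [(measurePreserving_eval _ i).map_eq, integral_sq_gaussianReal] at h
        exact h.symm
      simp [this]
    rw [hE] at hch
    have hv0 : 0 ≤ v := variance_nonneg _ _
    have := ENNReal.toReal_mono (by simp) hch
    rw [ENNReal.toReal_ofReal (div_nonneg (Finset.sum_nonneg fun _ _ => hv0) (by positivity))] at this
    refine le_trans (le_of_eq ?_) (this.trans (le_of_eq ?_))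
    · simp [measureReal_def, EuclideanSpace.real_norm_sq_eq]
    · simp only [Finset.sum_const, Finset.card_univ, Fintype.card_fin, nsmul_eq_mul]
      field_simp
  refine squeeze_zero' (Filter.Eventually.of_forall fun _ => measureReal_nonneg) hb ?_
  exact tendsto_const_div_atTop_nhds_zero_nat _

/-! ### Geometry of nested projections -/

section Projection

variable {E : Type*} [NormedAddCommGroup E] [InnerProductSpace ℝ E] [FiniteDimensional ℝ E]

theorem norm_sq_starProjection_eq_add_of_le {U V : Submodule ℝ E} (h : U ≤ V) (z : E) :
    ‖V.starProjection z‖ ^ 2 = ‖U.starProjection z‖ ^ 2 + ‖(Uᗮ ⊓ V).starProjection z‖ ^ 2 := by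
  have hV : V.starProjection z ∈ V := Submodule.starProjection_apply_mem _ _
  have hU : U.starProjection z ∈ U := Submodule.starProjection_apply_mem _ _
  have hVo : z - V.starProjection z ∈ Vᗮ := Submodule.sub_starProjection_mem_orthogonal z
  have hUo : z - U.starProjection z ∈ Uᗮ := Submodule.sub_starProjection_mem_orthogonal z
  have hw : V.starProjection z - U.starProjection z ∈ Uᗮ := by
    have := Uᗮ.sub_mem hUo (Submodule.orthogonal_le h hVo)
    simpa using this
  have hproj : (Uᗮ ⊓ V).starProjection z = V.starProjection z - U.starProjection z := by
    refine Submodule.eq_starProjection_of_mem_orthogonal ⟨hw, V.sub_mem hV (h hU)⟩ ?_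
    rw [show z - (V.starProjection z - U.starProjection z)
      = (z - V.starProjection z) + U.starProjection z by abel]
    refine Submodule.add_mem _ (Submodule.orthogonal_le inf_le_right hVo) ?_
    exact Submodule.orthogonal_le inf_le_left (Submodule.le_orthogonal_orthogonal U hU)
  have hin : inner ℝ (U.starProjection z) (V.starProjection z - U.starProjection z) = 0 :=
    (Submodule.mem_orthogonal _ _).1 hw _ hU
  rw [hproj]
  have := norm_add_sq_real (U.starProjection z) (V.starProjection z - U.starProjection z)
  rw [hin, add_sub_cancel] at this
  linarith

theorem norm_sub_starProjection_sq (U : Submodule ℝ E) (z : E) :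
    ‖z - U.starProjection z‖ ^ 2 = ‖z‖ ^ 2 - ‖U.starProjection z‖ ^ 2 := by
  have h := Submodule.norm_sq_eq_add_norm_sq_starProjection z U
  rw [Submodule.starProjection_orthogonal_val] at h
  linarith

theorem norm_add_sub_starProjection_sq_of_mem {U : Submodule ℝ E} {m : E} (hm : m ∈ U) (e : E) :
    ‖(m + e) - U.starProjection (m + e)‖ ^ 2 = ‖e‖ ^ 2 - ‖U.starProjection e‖ ^ 2 := by
  rw [map_add, Submodule.starProjection_eq_self_iff.2 hm, add_sub_add_left_eq_sub,
    norm_sub_starProjection_sq]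

/-- The residual sum of squares of a model that misses part of the mean `m`. -/
theorem le_norm_add_sub_starProjection_sq {U V : Submodule ℝ E} (hUV : U ≤ V) {m : E}
    (hm : m ∈ V) (e : E) :
    ‖m - U.starProjection m‖ ^ 2 / 2 + ‖e‖ ^ 2 - 3 * ‖V.starProjection e‖ ^ 2
      ≤ ‖(m + e) - U.starProjection (m + e)‖ ^ 2 := by
  set q := m - U.starProjection m with hq
  have hqU : q ∈ Uᗮ := Submodule.sub_starProjection_mem_orthogonal m
  have hqV : q ∈ V := V.sub_mem hm (hUV (Submodule.starProjection_apply_mem _ _))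
  have h1 : (m + e) - U.starProjection (m + e) = q + (e - U.starProjection e) := by
    rw [map_add, hq]; abel
  -- Since `q` lies in `V` and is orthogonal to `U`, the cross term sees only the part of the noise
  -- in `V`.
  have h2 : inner ℝ q (e - U.starProjection e) = inner ℝ q (V.starProjection e) := by
    rw [inner_sub_right, Submodule.inner_left_of_mem_orthogonal
      (Submodule.starProjection_apply_mem U e) hqU, sub_zero]
    have h3 : inner ℝ q (e - V.starProjection e) = 0 :=
      (Submodule.mem_orthogonal _ _).1 (Submodule.sub_starProjection_mem_orthogonal e) _ hqV
    rw [inner_sub_right] at h3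
    linarith
  have h4 : ‖U.starProjection e‖ ^ 2 ≤ ‖V.starProjection e‖ ^ 2 := by
    rw [norm_sq_starProjection_eq_add_of_le hUV]
    nlinarith [norm_nonneg ((Uᗮ ⊓ V).starProjection e)]
  have h5 := abs_le.1 (abs_real_inner_le_norm q (V.starProjection e))
  rw [h1, norm_add_sq_real, h2, norm_sub_starProjection_sq U e]
  -- The 3 is 2 from `2‖q‖v ≤ ‖q‖²/2 + 2v²`, where `v = ‖P_V e‖`, plus 1 from `‖P_U e‖² ≤ v²`.
  nlinarith [sq_nonneg (‖q‖ - 2 * ‖V.starProjection e‖)]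

end Projection

/-! ### Column spaces of the candidate models -/

section ColSpan

variable {n p : ℕ} (X : Matrix (Fin n) (Fin p) ℝ)

theorem colSpan_eq_span_image (S : Finset (Fin p)) :
    colSpan X S = Submodule.span ℝ ((fun j => (WithLp.toLp 2 (X.col j) :
      EuclideanSpace ℝ (Fin n))) '' S) := by
  rw [colSpan]
  congr 1
  ext v
  constructor
  · rintro ⟨j, rfl⟩
    exact ⟨j, j.2, rfl⟩
  · rintro ⟨j, hj, rfl⟩
    exact ⟨⟨j, hj⟩, rfl⟩

theorem colSpan_mono {S T : Finset (Fin p)} (h : S ⊆ T) : colSpan X S ≤ colSpan X T := by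
  rw [colSpan_eq_span_image, colSpan_eq_span_image]
  exact Submodule.span_mono (Set.image_mono (by exact_mod_cast h))

theorem colSpan_union (S T : Finset (Fin p)) :
    colSpan X (S ∪ T) = colSpan X S ⊔ colSpan X T := by
  simp_rw [colSpan_eq_span_image]
  rw [Finset.coe_union, Set.image_union, Submodule.span_union]

theorem finrank_colSpan_le (S : Finset (Fin p)) :
    Module.finrank ℝ (colSpan X S) ≤ S.card := by
  have h := finrank_range_le_card (R := ℝ)
    (fun j : S => (WithLp.toLp 2 ((subDesign X S).col j) : EuclideanSpace ℝ (Fin n)))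
  rwa [Fintype.card_coe] at h

theorem finrank_orthogonal_inf_colSpan_union_le (S T : Finset (Fin p)) :
    Module.finrank ℝ ((colSpan X S)ᗮ ⊓ colSpan X (S ∪ T) : Submodule ℝ _) ≤ T.card := by
  have h1 := Submodule.finrank_add_inf_finrank_orthogonal
    (colSpan_mono X (Finset.subset_union_left (s₁ := S) (s₂ := T)))
  have h2 := Submodule.finrank_add_le_finrank_add_finrank (colSpan X S) (colSpan X T)
  rw [← colSpan_union] at h2
  have h3 := finrank_colSpan_le X T
  omega

theorem meanResponse_mem_colSpan (β : Fin p → ℝ) :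
    meanResponse X β ∈ colSpan X (trueModel β) := by
  have h : meanResponse X β
      = ∑ j, β j • (WithLp.toLp 2 (X.col j) : EuclideanSpace ℝ (Fin n)) := by
    ext i
    simp [meanResponse, Matrix.mulVec, dotProduct, mul_comm]
  rw [h, colSpan_eq_span_image]
  refine Submodule.sum_mem _ fun j _ => ?_
  by_cases hj : β j = 0
  · simp [hj]
  · exact Submodule.smul_mem _ _ (Submodule.subset_span ⟨j, by simp [trueModel, hj], rfl⟩)

end ColSpan

/-! ### Deterministic comparison of the criteria -/

section Deterministic

variable {n p : ℕ} (X : Matrix (Fin n) (Fin p) ℝ) (β : Fin p → ℝ)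

theorem rss_add_of_mem_colSpan {S : Finset (Fin p)} {m : EuclideanSpace ℝ (Fin n)}
    (hm : m ∈ colSpan X S) (σ : ℝ) (z : EuclideanSpace ℝ (Fin n)) :
    rss X (m + σ • z) S = σ ^ 2 * (‖z‖ ^ 2 - ‖(colSpan X S).starProjection z‖ ^ 2) := by
  rw [rss, fitted, norm_add_sub_starProjection_sq_of_mem hm, map_smul, norm_smul, norm_smul,
    mul_pow, mul_pow, Real.norm_eq_abs, sq_abs]
  ring

/-- A model that properly contains the true one loses when the additional reduction of the
residual sum of squares is small. -/
theorem mdl_lt_mdl_of_ssubset {σ η : ℝ} (hσ : 0 < σ) (hη : 0 < η) (hη' : η ≤ 1 / 4)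
    (hn : 1 < n) {S : Finset (Fin p)} (hS : trueModel β ⊂ S) (z : EuclideanSpace ℝ (Fin n))
    (hlow : (1 - 2 * η) * n ≤ ‖z‖ ^ 2 - ‖(colSpan X S).starProjection z‖ ^ 2)
    (hup : ‖((colSpan X (trueModel β))ᗮ ⊓ colSpan X S).starProjection z‖ ^ 2
      ≤ (S \ trueModel β).card * ((1 - 3 * η) * (Real.log n + 2 * Real.log p))) :
    mdl X (meanResponse X β + σ • z) (trueModel β) < mdl X (meanResponse X β + σ • z) S := by
  have hm0 := meanResponse_mem_colSpan X β
  have hle := colSpan_mono X hS.subset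
  have hn0 : (0 : ℝ) < n := by exact_mod_cast (by omega : 0 < n)
  have hL : 0 < Real.log n := Real.log_pos (by exact_mod_cast hn)
  have hlp : 0 ≤ Real.log p := Real.log_natCast_nonneg p
  have hcard : (S.card : ℝ) = (trueModel β).card + (S \ trueModel β).card := by
    rw [add_comm]
    exact_mod_cast (Finset.card_sdiff_add_card_eq_card hS.subset).symm
  have hpos : (0 : ℝ) < (S \ trueModel β).card := by
    exact_mod_cast Finset.card_pos.2 (Finset.sdiff_nonempty.2 hS.2)
  set d : ℝ := ((S \ trueModel β).card : ℝ)
  set w := ‖((colSpan X (trueModel β))ᗮ ⊓ colSpan X S).starProjection z‖ ^ 2 with hw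
  have hpy := norm_sq_starProjection_eq_add_of_le hle z
  set R := ‖z‖ ^ 2 - ‖(colSpan X S).starProjection z‖ ^ 2 with hR
  have h0 : rss X (meanResponse X β + σ • z) (trueModel β) = σ ^ 2 * (R + w) := by
    rw [rss_add_of_mem_colSpan X hm0]
    congr 1
    linarith
  have h1 : rss X (meanResponse X β + σ • z) S = σ ^ 2 * R :=
    rss_add_of_mem_colSpan X (hle hm0) σ z
  have hηn : 0 < (1 - 2 * η) * n := by apply mul_pos <;> linarith
  have hRpos : 0 < R := by linarith
  have hw0 : 0 ≤ w := by positivity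
  have hlog : Real.log (σ ^ 2 * (R + w) / n) - Real.log (σ ^ 2 * R / n) ≤ w / R := by
    rw [← Real.log_div (by positivity) (by positivity),
      show σ ^ 2 * (R + w) / n / (σ ^ 2 * R / n) = 1 + w / R by field_simp]
    linarith [Real.log_le_sub_one_of_pos (show 0 < 1 + w / R by positivity)]
  have hT : 0 < Real.log n + 2 * Real.log p := by linarith
  -- The gap between `1 - 3η` and `1 - 2η` makes the inequality strict.
  have hwR : n * (w / R) < d * (Real.log n + 2 * Real.log p) := by
    rw [← mul_div_assoc, div_lt_iff₀ hRpos]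
    have hdT := mul_pos hpos hT
    calc n * w ≤ n * (d * ((1 - 3 * η) * (Real.log n + 2 * Real.log p))) := by gcongr
      _ = d * (Real.log n + 2 * Real.log p) * ((1 - 3 * η) * n) := by ring
      _ < d * (Real.log n + 2 * Real.log p) * ((1 - 2 * η) * n) := by
        gcongr; linarith
      _ ≤ _ := by gcongr
  rw [mdl, mdl, h0, h1, hcard]
  nlinarith [mul_le_mul_of_nonneg_left hlog hn0.le]

/-- A model that misses a part of the true one loses when `δ(S)` is large. -/
theorem mdl_lt_mdl_of_le_delta {σ A B g s : ℝ} (hσ : 0 < σ) (hn : 1 < n) {S : Finset (Fin p)}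
    (z : EuclideanSpace ℝ (Fin n))
    (hlow : 0 < ‖z‖ ^ 2 - ‖(colSpan X (trueModel β)).starProjection z‖ ^ 2)
    (hup : ‖z‖ ^ 2 ≤ 2 * n)
    (hB : ‖(colSpan X (S ∪ trueModel β)).starProjection z‖ ^ 2 ≤ B * Real.log n)
    (hδ : 2 * (3 * σ ^ 2 * B + A) * Real.log n ≤ delta X β S)
    (hs : (trueModel β).card ≤ s) (hg : Real.log p ≤ g * Real.log n) (hg0 : 0 ≤ g)
    (hA : 6 * σ ^ 2 * (s / 2 + s * g + 1) ≤ A) (hAn : A * Real.log n ≤ σ ^ 2 * n) :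
    mdl X (meanResponse X β + σ • z) (trueModel β) < mdl X (meanResponse X β + σ • z) S := by
  have hm0 := meanResponse_mem_colSpan X β
  have hn0 : (0 : ℝ) < n := by exact_mod_cast (by omega : 0 < n)
  have hL : 0 < Real.log n := Real.log_pos (by exact_mod_cast hn)
  have hlp : 0 ≤ Real.log p := Real.log_natCast_nonneg p
  have hs0 : 0 ≤ s := (Nat.cast_nonneg _).trans hs
  have hσ2 : 0 < σ ^ 2 := by positivity
  have hA0 : 0 < A := lt_of_lt_of_le (by positivity) hA
  have h0 := rss_add_of_mem_colSpan X hm0 σ z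
  have h1 := le_norm_add_sub_starProjection_sq
    (colSpan_mono X (Finset.subset_union_left (s₁ := S) (s₂ := trueModel β)))
    (colSpan_mono X (Finset.subset_union_right (s₁ := S) (s₂ := trueModel β)) hm0) (σ • z)
  rw [map_smul, norm_smul, norm_smul, mul_pow, mul_pow, Real.norm_eq_abs, sq_abs] at h1
  change delta X β S / 2 + _ - _ ≤ rss X (meanResponse X β + σ • z) S at h1
  set r := rss X (meanResponse X β + σ • z) S
  set r0 := rss X (meanResponse X β + σ • z) (trueModel β)
  set L := Real.log n
  have hr0 : 0 < r0 := by rw [h0]; positivity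
  have hr0' : r0 ≤ σ ^ 2 * ‖z‖ ^ 2 := by
    rw [h0]
    gcongr
    linarith [sq_nonneg ‖(colSpan X (trueModel β)).starProjection z‖]
  have hAL : 0 < A * L := mul_pos hA0 hL
  have hr : r0 + A * L ≤ r := by
    have := mul_le_mul_of_nonneg_left hB hσ2.le
    nlinarith
  have hrpos : 0 < r := by linarith
  -- Uses `log x ≥ 1 - 1/x`; the 3 comes from `r0 ≤ 2σ²n` and `A L ≤ σ²n`.
  have hlog : A * L / (3 * σ ^ 2 * n) ≤ Real.log (r / n) - Real.log (r0 / n) := by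
    have hbase : 0 < r0 + A * L := by linarith
    have h2 : Real.log ((r0 + A * L) / r0) ≤ Real.log (r / n) - Real.log (r0 / n) := by
      rw [← Real.log_div (by positivity) (by positivity), div_div_div_cancel_right₀ hn0.ne']
      gcongr
    have h3 := Real.one_sub_inv_le_log_of_pos (show 0 < (r0 + A * L) / r0 by positivity)
    have h4 : 1 - ((r0 + A * L) / r0)⁻¹ = A * L / (r0 + A * L) := by field_simp; ring
    have h5 : A * L / (3 * σ ^ 2 * n) ≤ A * L / (r0 + A * L) := by
      gcongr
      nlinarith
    linarith
  -- The first two terms pay for the penalty of `S₀`; the extra 1 gives strictness.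
  have h6 : (s / 2 + s * g + 1) * L ≤ n / 2 * (Real.log (r / n) - Real.log (r0 / n)) := by
    calc (s / 2 + s * g + 1) * L = n / 2 * (6 * σ ^ 2 * (s / 2 + s * g + 1) * L
          / (3 * σ ^ 2 * n)) := by field_simp; ring
      _ ≤ n / 2 * (A * L / (3 * σ ^ 2 * n)) := by gcongr
      _ ≤ _ := by gcongr
  have h7 : ((trueModel β).card : ℝ) / 2 * L + (trueModel β).card * Real.log p
      ≤ s / 2 * L + s * (g * L) := by gcongr
  have h8 : 0 ≤ (S.card : ℝ) / 2 * L + S.card * Real.log p := by positivity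
  rw [mdl, mdl]
  nlinarith

end Deterministic

/-! ### Asymptotics and assembly -/

theorem hasLaw_toLp_div {Ω : Type*} [MeasurableSpace Ω] {P : Measure Ω} [IsProbabilityMeasure P]
    {n : ℕ} {ε : Fin n → Ω → ℝ} {σ : ℝ} (hσ : 0 < σ) (hindep : iIndepFun ε P)
    (hlaw : ∀ i, HasLaw (ε i) (gaussianReal 0 (Real.toNNReal (σ ^ 2))) P) :
    HasLaw (fun ω => (WithLp.toLp 2 fun i => ε i ω / σ : EuclideanSpace ℝ (Fin n)))
      (stdGaussian (EuclideanSpace ℝ (Fin n))) P := by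
  have h1 : ∀ i, HasLaw (fun ω => ε i ω / σ) (gaussianReal 0 1) P := fun i => by
    have h := gaussianReal_div_const (hlaw i) σ
    convert h using 2
    · simp
    · ext
      simp [max_eq_left (sq_nonneg σ), hσ.ne']
  have h2 : iIndepFun (fun i ω => ε i ω / σ) P :=
    hindep.comp (fun _ x => x / σ) fun _ => by fun_prop
  have hae : AEMeasurable (fun ω i => ε i ω / σ) P := aemeasurable_pi_lambda _ fun i =>
    (h1 i).aemeasurable
  have h3 : P.map (fun ω i => ε i ω / σ) = Measure.pi fun _ => gaussianReal 0 1 := by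
    rw [(iIndepFun_iff_map_fun_eq_pi_map fun i => (h1 i).aemeasurable).1 h2]
    simp_rw [fun i => (h1 i).map_eq]
  refine ⟨(WithLp.measurable_toLp 2 _).comp_aemeasurable hae, ?_⟩
  rw [← map_pi_eq_stdGaussian, ← h3,
    AEMeasurable.map_map_of_aemeasurable (WithLp.measurable_toLp 2 _).aemeasurable hae]
  rfl

theorem exists_eventually_natCast_le_pow {p : ℕ → ℕ} {γ : ℝ}
    (hp : (fun n : ℕ => (p n : ℝ)) =O[atTop] (fun n : ℕ => (n : ℝ) ^ γ)) :
    ∃ g : ℕ, 0 < g ∧ ∀ᶠ n : ℕ in atTop, Real.log (p n) ≤ g * Real.log n := by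
  obtain ⟨C, hC⟩ := hp.bound
  obtain ⟨g, hg⟩ := exists_nat_ge γ
  -- The additional power of `n` absorbs the constant `C`.
  refine ⟨g + 1, by omega, ?_⟩
  filter_upwards [hC, eventually_ge_atTop 1, tendsto_natCast_atTop_atTop.eventually_ge_atTop C]
    with n h hn hCn
  have hn1 : (1 : ℝ) ≤ n := by exact_mod_cast hn
  rw [← Real.log_pow]
  rcases (p n).eq_zero_or_pos with h0 | h0
  · rw [h0, Nat.cast_zero, Real.log_zero]
    exact Real.log_nonneg (one_le_pow₀ hn1)
  refine Real.log_le_log (by exact_mod_cast h0) ?_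
  rw [Real.norm_of_nonneg (by positivity), Real.norm_of_nonneg (by positivity)] at h
  calc (p n : ℝ) ≤ C * (n : ℝ) ^ γ := h
    _ ≤ n * (n : ℝ) ^ (g : ℝ) := by gcongr
    _ = _ := by rw [Real.rpow_natCast, pow_succ, mul_comm]

/-- The union bound tends to zero as soon as `p exp (-t u)` does. -/
theorem tendsto_stdGaussian_real_exists_lt {t : ℝ} (ht0 : 0 ≤ t) (ht : t < 1 / 2) (p : ℕ → ℕ)
    (W : ∀ n, Finset (Fin (p n)) → Submodule ℝ (EuclideanSpace ℝ (Fin n)))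
    (hW : ∀ n T, Module.finrank ℝ (W n T) ≤ T.card) (u : ℕ → ℝ) {a : ℝ} (ha : 0 < a)
    (hu : ∀ᶠ n : ℕ in atTop, Real.log (p n) - t * u n ≤ -a * Real.log n) :
    Tendsto (fun n => (stdGaussian (EuclideanSpace ℝ (Fin n))).real
      {z | ∃ T, T.card * u n < ‖(W n T).starProjection z‖ ^ 2}) atTop (𝓝 0) := by
  set c := ∫ x, Real.exp (t * x ^ 2) ∂(gaussianReal 0 1)
  have hc : 1 ≤ c := one_le_integral_exp_mul_sq ht0 ht
  have hlim : Tendsto (fun n : ℕ => Real.exp (c * Real.exp (-a * Real.log n)) - 1) atTop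
      (𝓝 0) := by
    have h1 : Tendsto (fun n : ℕ => -a * Real.log n) atTop atBot :=
      (Real.tendsto_log_atTop.comp tendsto_natCast_atTop_atTop).const_mul_atTop_of_neg
        (by linarith)
    have h2 := (Real.tendsto_exp_atBot.comp h1).const_mul c
    have h3 := ((Real.continuous_exp.tendsto _).comp h2).sub_const 1
    simpa using h3
  refine squeeze_zero' (Filter.Eventually.of_forall fun _ => measureReal_nonneg) ?_ hlim
  filter_upwards [hu] with n hn
  refine (stdGaussian_real_exists_lt_norm_sq_starProjection_le ht0 ht (W n) (hW n) (u n)).trans ?_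
  refine sub_le_sub_right (Real.exp_le_exp.2 ?_) 1
  have hp : (p n : ℝ) ≤ Real.exp (Real.log (p n)) := Real.le_exp_log _
  calc (p n : ℝ) * (c * Real.exp (-t * u n))
      ≤ Real.exp (Real.log (p n)) * (c * Real.exp (-t * u n)) := by gcongr
    _ = c * Real.exp (Real.log (p n) - t * u n) := by
      rw [mul_left_comm, ← Real.exp_add]
      ring_nf
    _ ≤ _ := by gcongr

theorem response_eq {n p : ℕ} (X : Matrix (Fin n) (Fin p) ℝ) (β : Fin p → ℝ) {σ : ℝ} (hσ : 0 < σ)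
    (e : Fin n → ℝ) :
    response X β e = meanResponse X β + σ • WithLp.toLp 2 fun i => e i / σ := by
  ext i
  simp [response, meanResponse, mul_div_cancel₀ _ hσ.ne']

theorem eventually_const_mul_log_le (a : ℝ) {b : ℝ} (hb : 0 < b) :
    ∀ᶠ n : ℕ in atTop, a * Real.log n ≤ b * n := by
  have h := ((Real.isLittleO_log_id_atTop.const_mul_left a).comp_tendsto
    tendsto_natCast_atTop_atTop).bound hb
  filter_upwards [h] with n hn
  simpa using (le_abs_self _).trans hn

/-- The noise vectors, rescaled by `1 / σ`, for which the criterion may fail have asymptotically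
negligible probability. -/
theorem exists_tendsto_stdGaussian_real_and_mdl_lt
    {p : ℕ → ℕ} (X : ∀ n, Matrix (Fin n) (Fin (p n)) ℝ) (β : ∀ n, Fin (p n) → ℝ)
    {σ : ℝ} (hσ : 0 < σ) {s : ℕ} (hs : ∀ n, (trueModel (β n)).card ≤ s)
    {k : ℝ} (hk : 0 ≤ k) (hident : AsympIdentifiable X β k)
    {γ : ℝ} (hp : (fun n : ℕ => (p n : ℝ)) =O[atTop] (fun n : ℕ => (n : ℝ) ^ γ)) :
    ∃ bad : ∀ n, Set (EuclideanSpace ℝ (Fin n)),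
      Tendsto (fun n => (stdGaussian (EuclideanSpace ℝ (Fin n))).real (bad n)) atTop (𝓝 0) ∧
      ∀ᶠ n in atTop, ∀ z ∉ bad n, ∀ S : Finset (Fin (p n)), S ≠ trueModel (β n) →
        (S.card : ℝ) ≤ k * ((trueModel (β n)).card : ℝ) →
          mdl (X n) (meanResponse (X n) (β n) + σ • z) (trueModel (β n))
            < mdl (X n) (meanResponse (X n) (β n) + σ • z) S := by
  obtain ⟨g, hg0, hg⟩ := exists_eventually_natCast_le_pow hp
  have hg1 : (1 : ℝ) ≤ g := by exact_mod_cast hg0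
  -- Makes `4η log p ≤ (log n) / 8`, so the slack in the tail bound costs only part of the spare
  -- `(log n) / 2`.
  obtain ⟨η, hη⟩ : ∃ η : ℝ, η * (32 * g) = 1 := ⟨1 / (32 * g), by field_simp⟩
  have hη0 : 0 < η := by
    by_contra h
    nlinarith
  have hη1 : η ≤ 1 / 32 := by nlinarith
  set C : ℝ := 4 * (g + 1) with hC
  set B : ℝ := (k * s + s) * C with hB
  set A : ℝ := 6 * σ ^ 2 * (s / 2 + s * g + 1) with hA
  have hC0 : 0 < C := by positivity
  have hB0 : 0 ≤ B := by positivity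
  have hlogn : ∀ n : ℕ, 0 ≤ Real.log n := fun n => Real.log_natCast_nonneg n
  have hlp : ∀ n, 0 ≤ Real.log (p n) := fun n => Real.log_natCast_nonneg _
  have h1 := tendsto_stdGaussian_real_le_abs_norm_sq_sub hη0
  have h2 := tendsto_stdGaussian_real_exists_lt (t := (1 - η) / 2) (by linarith) (by linarith) p
    (fun n T => colSpan (X n) T) (fun n T => finrank_colSpan_le (X n) T)
    (fun n => C * Real.log n) one_pos (by
      filter_upwards [hg] with n hn
      nlinarith [mul_nonneg hC0.le (hlogn n)])
  have h3 := tendsto_stdGaussian_real_exists_lt (t := (1 - η) / 2) (by linarith) (by linarith) p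
    (fun n T => (colSpan (X n) (trueModel (β n)))ᗮ ⊓ colSpan (X n) (trueModel (β n) ∪ T))
    (fun n T => finrank_orthogonal_inf_colSpan_union_le (X n) (trueModel (β n)) T)
    -- With `(1 - η)(1 - 3η) ≥ 1 - 4η`, the exponent is at most `-(1/2 - 1/16 - 1/8) log n`, hence
    -- below `-(log n) / 4`.
    (fun n => (1 - 3 * η) * (Real.log n + 2 * Real.log (p n))) (a := 1 / 4) (by norm_num) (by
      filter_upwards [hg] with n hn
      have e1 : (1 - 4 * η) / 2 * (Real.log n + 2 * Real.log (p n))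
          ≤ (1 - η) / 2 * ((1 - 3 * η) * (Real.log n + 2 * Real.log (p n))) := by
        rw [← mul_assoc]
        refine mul_le_mul_of_nonneg_right ?_ (by linarith [hlogn n, hlp n])
        nlinarith
      have e2 : 4 * η * Real.log (p n) ≤ 1 / 8 * Real.log n := by
        calc 4 * η * Real.log (p n) ≤ 4 * η * (g * Real.log n) := by gcongr
          _ = η * (32 * g) * (1 / 8 * Real.log n) := by ring
          _ = _ := by rw [hη, one_mul]
      nlinarith [mul_le_mul_of_nonneg_right hη1 (hlogn n)])
  refine ⟨fun n => {z | η * n ≤ |‖z‖ ^ 2 - n|} ∪ {z | ∃ T : Finset (Fin (p n)),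
      T.card * (C * Real.log n) < ‖(colSpan (X n) T).starProjection z‖ ^ 2} ∪
      {z | ∃ T : Finset (Fin (p n)), T.card * ((1 - 3 * η) * (Real.log n + 2 * Real.log (p n)))
        < ‖((colSpan (X n) (trueModel (β n)))ᗮ
          ⊓ colSpan (X n) (trueModel (β n) ∪ T)).starProjection z‖ ^ 2}, ?_, ?_⟩
  · have h := (h1.add h2).add h3
    simp only [add_zero] at h
    refine squeeze_zero (fun _ => measureReal_nonneg) (fun n => ?_) h
    exact (measureReal_union_le _ _).trans (add_le_add_left (measureReal_union_le _ _) _)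
  filter_upwards [hg, hident (2 * (3 * σ ^ 2 * B + A)), eventually_gt_atTop 1,
    eventually_const_mul_log_le B hη0, eventually_const_mul_log_le A (pow_pos hσ 2)]
    with n hgn hδ hn hBn hAn z hz S hS hSk
  simp only [Set.mem_union, Set.mem_ofPred_eq, not_or, not_le, not_exists, not_lt] at hz
  obtain ⟨⟨hz1, hz2⟩, hz3⟩ := hz
  rw [abs_lt] at hz1
  have hn0 : (0 : ℝ) < n := by exact_mod_cast (by omega : 0 < n)
  have hL : 0 < Real.log n := Real.log_pos (by exact_mod_cast hn)
  have hs' : ((trueModel (β n)).card : ℝ) ≤ s := by exact_mod_cast hs n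
  have hSk' : (S.card : ℝ) ≤ k * s := hSk.trans (by gcongr)
  have hproj : ∀ T : Finset (Fin (p n)), (T.card : ℝ) ≤ k * s + s →
      ‖(colSpan (X n) T).starProjection z‖ ^ 2 ≤ B * Real.log n := fun T hT => by
    rw [hB, mul_assoc]
    exact (hz2 T).trans (mul_le_mul_of_nonneg_right hT (by positivity))
  have hks : 0 ≤ k * s := by positivity
  have hηn : η * n ≤ 1 / 32 * n := by gcongr
  by_cases hsub : trueModel (β n) ⊆ S
  · refine mdl_lt_mdl_of_ssubset (X n) (β n) hσ hη0 (by linarith) hn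
      (hsub.ssubset_of_ne hS.symm) z ?_ ?_
    · linarith [hproj S (by linarith [(Nat.cast_nonneg s : (0 : ℝ) ≤ s)])]
    · have h := hz3 (S \ trueModel (β n))
      rwa [Finset.union_sdiff_of_subset hsub] at h
  · refine mdl_lt_mdl_of_le_delta (X n) (β n) (A := A) (B := B) (g := g) (s := s) hσ hn z
      ?_ (by linarith) (hproj _ ?_) ((le_div_iff₀ hL).1 (hδ S hsub hSk)) hs' hgn (by linarith)
      le_rfl hAn
    · linarith [hproj (trueModel (β n)) (by linarith)]
    · have h : ((S ∪ trueModel (β n)).card : ℝ) ≤ S.card + (trueModel (β n)).card := by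
        exact_mod_cast Finset.card_union_le _ _
      linarith

end LinModel

theorem theorem1
    (p : ℕ → ℕ) (X : ∀ n, Matrix (Fin n) (Fin (p n)) ℝ) (β : ∀ n, Fin (p n) → ℝ)
    (σ : ℝ) (hσ : 0 < σ)
    {Ω : ℕ → Type*} [∀ n, MeasurableSpace (Ω n)]
    (P : ∀ n, Measure (Ω n)) [∀ n, IsProbabilityMeasure (P n)]
    (ε : ∀ n, Fin n → Ω n → ℝ)
    (hε_indep : ∀ n, iIndepFun (ε n) (P n))
    (hε_law : ∀ n i, HasLaw (ε n i) (gaussianReal 0 (Real.toNNReal (σ ^ 2))) (P n))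
    (s : ℕ) (hs : ∀ n, (LinModel.trueModel (β n)).card ≤ s)
    (k : ℝ) (hk : 1 < k)
    (hident : LinModel.AsympIdentifiable X β k)
    (γ : ℝ) (hp : (fun n : ℕ => (p n : ℝ)) =O[atTop] (fun n : ℕ => (n : ℝ) ^ γ)) :
    Tendsto
      (fun n : ℕ => P n {ω | ∀ S : Finset (Fin (p n)),
        S ≠ LinModel.trueModel (β n) →
        (S.card : ℝ) ≤ k * ((LinModel.trueModel (β n)).card : ℝ) →
          LinModel.mdl (X n) (LinModel.response (X n) (β n) (fun i => ε n i ω))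
              (LinModel.trueModel (β n))
            < LinModel.mdl (X n) (LinModel.response (X n) (β n) (fun i => ε n i ω)) S})
      atTop (𝓝 1) := by
  obtain ⟨bad, hbad, hmdl⟩ := LinModel.exists_tendsto_stdGaussian_real_and_mdl_lt X β hσ hs
    (zero_le_one.trans hk.le) hident hp
  have hlim : Tendsto (fun n => 1 - stdGaussian (EuclideanSpace ℝ (Fin n)) (bad n)) atTop
      (𝓝 1) := by
    have h := ENNReal.tendsto_ofReal hbad
    simp only [ENNReal.ofReal_zero] at h
    simpa using ENNReal.Tendsto.sub tendsto_const_nhds h (Or.inl ENNReal.one_ne_top)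
  refine tendsto_of_tendsto_of_tendsto_of_le_of_le' hlim tendsto_const_nhds ?_
    (Filter.Eventually.of_forall fun n => prob_le_one)
  filter_upwards [hmdl] with n hn
  have hZ := LinModel.hasLaw_toLp_div hσ (hε_indep n) (hε_law n)
  -- This inequality and the subadditivity below hold for arbitrary sets, so no measurability of the
  -- events is needed.
  have hle := Measure.le_map_apply hZ.aemeasurable (bad n)
  rw [hZ.map_eq] at hle
  refine (tsub_le_tsub_left hle 1).trans ?_
  rw [tsub_le_iff_right, ← measure_univ (μ := P n)]
  refine (measure_mono fun ω _ => ?_).trans (measure_union_le _ _)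
  by_cases hω : (WithLp.toLp 2 fun i => ε n i ω / σ : EuclideanSpace ℝ (Fin n)) ∈ bad n
  · exact Or.inr hω
  · refine Or.inl fun S hS hSk => ?_
    rw [LinModel.response_eq _ _ hσ]
    exact hn _ hω S hS hSk
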